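/- Let $n\ge 0$ be an integer, let $t,u,v\in\mathbb C$, and let $W$ be one of the classical Weyl groups, realised as groups of signed permutations of $\{1,\dots,n\}$: $W_{A_{n-1}}=S_n$ (all permutations), $W_{B_n}$ (all signed permutations), or $W_{D_n}$ (the signed permutations with an even number of sign changes). For $i\ne j$ let $s_{ij}$ be the transposition of $i$ and $j$, let $\overline s_{ij}$ be the transposition of $i$ and $j$ coupled with the sign changes at $i$ and $j$, and let $\tau_i$ be the sign change at $i$. For $\sigma\in W$ let $\sigma^*\in S_n$ be the underlying permutation, with the signs forgotten. For letters $b_1,\dots,b_n$, the skew-polynomial algebra $\mathcal C[b_1,\dots,b_n]$ is the unital associative $\mathbb C$-algebra generated by $b_1,\dots,b_n$ subject to $b_ib_j+b_jb_i=0$ for $i\neq j$ (the squares $b_i^2$ are not set to zero). The odd double affine Hecke algebra $\ddot{\mathfrak H}_W=\ddot{\mathfrak H}_W(t,u,v)$ is the unital associative $\mathbb C$-algebra generated by $\xi_1,\dots,\xi_n$, $\eta_1,\dots,\eta_n$ and the group algebra $\mathbb CW$, subject to $$\eta_i\eta_j=-\eta_j\eta_i,\qquad \xi_i\xi_j=-\xi_j\xi_i\qquad(i\ne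 j),$$ $$\sigma\,\xi_j=\xi_{\sigma^*(j)}\,\sigma,\qquad \sigma\,\eta_j=\eta_{\sigma^*(j)}\,\sigma\qquad(\sigma\in W,\ 1\le j\le n),$$ and the following relations, in which $i\ne j$: * type $A_{n-1}$: $\ \eta_i\xi_j+\xi_j\eta_i=u\,s_{ij}$ and $\ \eta_i\xi_i+\xi_i\eta_i=t+u\sum_{k\ne i}s_{ki}$; * type $D_n$: $\ \eta_i\xi_j+\xi_j\eta_i=u\,(s_{ij}+\overline s_{ij})$ and $\ \eta_i\xi_i+\xi_i\eta_i=t+u\sum_{k\ne i}(s_{ki}+\overline s_{ki})$; * type $B_n$: $\ \eta_i\xi_j+\xi_j\eta_i=u\,(s_{ij}+\overline s_{ij})$ and $\ \eta_i\xi_i+\xi_i\eta_i=t+u\sum_{k\ne i}(s_{ki}+\overline s_{ki})+v\,\tau_i$. **Theorem.** The canonical algebra homomorphisms from $\mathcal C[\xi_1,\dots,\xi_n]$, $\mathbb CW$ and $\mathcal C[\eta_1,\dots,\eta_n]$ to $\ddot{\mathfrak H}_W$ are injective, and multiplication of these subalgebras, $$\mathcal C[\xi_1,\dots,\xi_n]\otimes\mathbb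 CW\otimes\mathcal C[\eta_1,\dots,\eta_n]\longrightarrow\ddot{\mathfrak H}_W,\qquad f\otimes w\otimes g\mapsto fwg,$$ is an isomorphism of vector spaces. Equivalently, the elements $\xi^\alpha\sigma\eta^\gamma$ with $\sigma\in W$ and $\alpha,\gamma\in\mathbb Z_{\ge0}^n$ form a basis of $\ddot{\mathfrak H}_W$, where $\xi^\alpha=\xi_1^{\alpha_1}\cdots\xi_n^{\alpha_n}$ and $\eta^\gamma=\eta_1^{\gamma_1}\cdots\eta_n^{\gamma_n}$. -/

import Mathlib

noncomputable section

namespace OddDaHa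

open scoped TensorProduct

/-! ### The classical Weyl groups as groups of signed permutations -/

/-- Signed permutations of `n` letters. The pair `⟨ε, π⟩` acts on the standard basis of `ℂⁿ`
by `e_i ↦ ε (π i) • e_(π i)`; it is the product of the permutation `π` followed by the
sign changes `ε`. -/
abbrev SignedPerm (n : ℕ) : Type :=
  (Fin n → ℤˣ) ⋊[(mulAutArrow : Equiv.Perm (Fin n) →* MulAut (Fin n → ℤˣ))] Equiv.Perm (Fin n)

/-- The three classical families. -/
inductive ClassicalType : Type
  | A
  | B
  | D

/-- The classical Weyl groups on `n` letters: for `A` the permutations (the symmetric group `S_n`,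
of type `A_{n-1}`), for `B` all signed permutations (type `B_n`), for `D` the signed permutations
with an even number of signs (type `D_n`). -/
def weylGroup : ClassicalType → (n : ℕ) → Subgroup (SignedPerm n)
  | .A, _ => (SemidirectProduct.inr).range
  | .B, _ => ⊤
  | .D, n =>
    { carrier := {w | ∏ i, w.left i = 1}
      one_mem' := by simp
      mul_mem' := by
        intro a b ha hb
        simp only [Set.mem_ofPred_eq, SemidirectProduct.mul_left, Pi.mul_apply,
          Finset.prod_mul_distrib] at ha hb ⊢
        rw [ha, one_mul, ← hb]
        exact Equiv.prod_comp (a.right⁻¹ : Equiv.Perm (Fin n)) b.left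
      inv_mem' := by
        intro a ha
        simp only [Set.mem_ofPred_eq, SemidirectProduct.inv_left] at ha ⊢
        have h : ∏ i, (a.left⁻¹) i = 1 := by
          simp only [Pi.inv_apply, Finset.prod_inv_distrib, ha, inv_one]
        rw [← h]
        exact Equiv.prod_comp (a.right⁻¹⁻¹ : Equiv.Perm (Fin n)) (a.left⁻¹) }

/-- The sign change `τ_i` at `i`. -/
def signChange {n : ℕ} (i : Fin n) : SignedPerm n :=
  SemidirectProduct.inl (Pi.mulSingle i (-1))

/-- The transposition `s_{ij}` of `i` and `j`. -/
def transp {n : ℕ} (i j : Fin n) : SignedPerm n :=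
  SemidirectProduct.inr (Equiv.swap i j)

/-- `s̄_{ij}`: the transposition of `i` and `j` coupled with the sign changes at `i` and `j`. -/
def transpBar {n : ℕ} (i j : Fin n) : SignedPerm n :=
  signChange i * signChange j * transp i j

lemma transp_mem (X : ClassicalType) {n : ℕ} (i j : Fin n) : transp i j ∈ weylGroup X n := by
  cases X
  · exact ⟨_, rfl⟩
  · exact Subgroup.mem_top _
  · change ∏ k, (transp i j).left k = 1
    simp [transp]

lemma transpBar_mem_D {n : ℕ} (i j : Fin n) : transpBar i j ∈ weylGroup .D n := by
  change ∏ k, (transpBar i j).left k = 1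
  simp [transpBar, transp, signChange, Finset.prod_mul_distrib]

/-- The homomorphism `σ ↦ σ^*` from `W` to `S_n` that forgets the signs. -/
def unsign (X : ClassicalType) (n : ℕ) : weylGroup X n →* Equiv.Perm (Fin n) :=
  SemidirectProduct.rightHom.comp (weylGroup X n).subtype

/-! ### Skew-polynomial algebras -/

/-- The relations `b_i b_j + b_j b_i = 0` for `i ≠ j`; the squares `b_i ^ 2` are left free. -/
inductive SkewRel (n : ℕ) : FreeAlgebra ℂ (Fin n) → FreeAlgebra ℂ (Fin n) → Prop
  | anticomm (i j : Fin n) (h : i ≠ j) :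
      SkewRel n (FreeAlgebra.ι ℂ i * FreeAlgebra.ι ℂ j + FreeAlgebra.ι ℂ j * FreeAlgebra.ι ℂ i) 0

/-- The skew-polynomial algebra on `n` generators. -/
abbrev SkewPoly (n : ℕ) : Type := RingQuot (SkewRel n)

/-! ### The odd double affine Hecke algebra -/

/-- The generators `ξ_i`, `η_i` and the elements of `W`. -/
inductive Gen (X : ClassicalType) (n : ℕ) : Type
  | xi (i : Fin n)
  | eta (i : Fin n)
  | grp (σ : weylGroup X n)

/-- The free algebra in which the defining relations are written. -/
abbrev Free (X : ClassicalType) (n : ℕ) : Type := FreeAlgebra ℂ (Gen X n)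

/-- The free generator `ξ_i`. -/
def fxi {X : ClassicalType} {n : ℕ} (i : Fin n) : Free X n := FreeAlgebra.ι ℂ (Gen.xi i)

/-- The free generator `η_i`. -/
def feta {X : ClassicalType} {n : ℕ} (i : Fin n) : Free X n := FreeAlgebra.ι ℂ (Gen.eta i)

/-- The free generator attached to a group element. -/
def fgrp {X : ClassicalType} {n : ℕ} (σ : weylGroup X n) : Free X n := FreeAlgebra.ι ℂ (Gen.grp σ)

/-- The element by which the parameter `u` is multiplied: `s_{ij}` in type `A`, and
`s_{ij} + s̄_{ij}` in types `B` and `D`. -/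
def reflTerm : (X : ClassicalType) → {n : ℕ} → Fin n → Fin n → Free X n
  | .A, _, i, j => fgrp ⟨transp i j, transp_mem .A i j⟩
  | .B, _, i, j => fgrp ⟨transp i j, transp_mem .B i j⟩ + fgrp ⟨transpBar i j, Subgroup.mem_top _⟩
  | .D, _, i, j => fgrp ⟨transp i j, transp_mem .D i j⟩ + fgrp ⟨transpBar i j, transpBar_mem_D i j⟩

/-- The element by which the parameter `v` is multiplied: `τ_i` in type `B`, absent otherwise. -/
def shortTerm : (X : ClassicalType) → {n : ℕ} → Fin n → Free X n
  | .B, _, i => fgrp ⟨signChange i, Subgroup.mem_top _⟩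
  | .A, _, _ => 0
  | .D, _, _ => 0

/-- The defining relations of the odd double affine Hecke algebra with parameters `t`, `u`, `v`. -/
inductive HORel (X : ClassicalType) (n : ℕ) (t u v : ℂ) : Free X n → Free X n → Prop
  | grp_one : HORel X n t u v (fgrp 1) 1
  | grp_mul (σ τ : weylGroup X n) : HORel X n t u v (fgrp (σ * τ)) (fgrp σ * fgrp τ)
  | eta_eta (i j : Fin n) (h : i ≠ j) : HORel X n t u v (feta i * feta j) (-(feta j * feta i))
  | xi_xi (i j : Fin n) (h : i ≠ j) : HORel X n t u v (fxi i * fxi j) (-(fxi j * fxi i))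
  | grp_xi (σ : weylGroup X n) (j : Fin n) :
      HORel X n t u v (fgrp σ * fxi j) (fxi (unsign X n σ j) * fgrp σ)
  | grp_eta (σ : weylGroup X n) (j : Fin n) :
      HORel X n t u v (fgrp σ * feta j) (feta (unsign X n σ j) * fgrp σ)
  | eta_xi_ne (i j : Fin n) (h : i ≠ j) :
      HORel X n t u v (feta i * fxi j + fxi j * feta i) (u • reflTerm X i j)
  | eta_xi_self (i : Fin n) :
      HORel X n t u v (feta i * fxi i + fxi i * feta i)
        (t • 1 + u • (∑ k ∈ Finset.univ.erase i, reflTerm X k i) + v • shortTerm X i)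

/-- The odd double affine Hecke algebra of type `X` on `n` letters. -/
abbrev HO (X : ClassicalType) (n : ℕ) (t u v : ℂ) : Type := RingQuot (HORel X n t u v)

/-- The generator `ξ_i`. -/
def xi (X : ClassicalType) (n : ℕ) (t u v : ℂ) (i : Fin n) : HO X n t u v := RingQuot.mkAlgHom ℂ (HORel X n t u v) (fxi i)

/-- The generator `η_i`. -/
def eta (X : ClassicalType) (n : ℕ) (t u v : ℂ) (i : Fin n) : HO X n t u v := RingQuot.mkAlgHom ℂ (HORel X n t u v) (feta i)

/-- The canonical homomorphism from `W` to the multiplicative monoid of the algebra. -/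
def grp (X : ClassicalType) (n : ℕ) (t u v : ℂ) : weylGroup X n →* HO X n t u v where
  toFun σ := RingQuot.mkAlgHom ℂ (HORel X n t u v) (fgrp σ)
  map_one' := (RingQuot.mkAlgHom_rel ℂ HORel.grp_one).trans (map_one _)
  map_mul' σ τ := (RingQuot.mkAlgHom_rel ℂ (HORel.grp_mul σ τ)).trans (map_mul _ _ _)

lemma xi_anticomm (X : ClassicalType) (n : ℕ) (t u v : ℂ) (i j : Fin n) (h : i ≠ j) :
    xi X n t u v i * xi X n t u v j + xi X n t u v j * xi X n t u v i = 0 := by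
  have := RingQuot.mkAlgHom_rel ℂ (HORel.xi_xi (X := X) (t := t) (u := u) (v := v) i j h)
  rw [map_mul, map_neg, map_mul] at this
  exact eq_neg_iff_add_eq_zero.mp this

lemma eta_anticomm (X : ClassicalType) (n : ℕ) (t u v : ℂ) (i j : Fin n) (h : i ≠ j) :
    eta X n t u v i * eta X n t u v j + eta X n t u v j * eta X n t u v i = 0 := by
  have := RingQuot.mkAlgHom_rel ℂ (HORel.eta_eta (X := X) (t := t) (u := u) (v := v) i j h)
  rw [map_mul, map_neg, map_mul] at this
  exact eq_neg_iff_add_eq_zero.mp this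

/-- The algebra homomorphism out of the skew-polynomial algebra that is given by a family of
pairwise anticommuting elements. -/
def skewLift (n : ℕ) {R : Type} [Ring R] [Algebra ℂ R] (b : Fin n → R)
    (hb : ∀ i j, i ≠ j → b i * b j + b j * b i = 0) : SkewPoly n →ₐ[ℂ] R :=
  RingQuot.liftAlgHom ℂ ⟨FreeAlgebra.lift ℂ b, by
    rintro _ _ ⟨i, j, h⟩
    simpa using hb i j h⟩

/-- The canonical homomorphism `C[ξ_1, …, ξ_n] → HO`. -/
def xiHom (X : ClassicalType) (n : ℕ) (t u v : ℂ) : SkewPoly n →ₐ[ℂ] HO X n t u v :=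
  skewLift n (xi X n t u v) (xi_anticomm X n t u v)

/-- The canonical homomorphism `C[η_1, …, η_n] → HO`. -/
def etaHom (X : ClassicalType) (n : ℕ) (t u v : ℂ) : SkewPoly n →ₐ[ℂ] HO X n t u v :=
  skewLift n (eta X n t u v) (eta_anticomm X n t u v)

/-- The canonical homomorphism `ℂW → HO`. -/
def grpHom (X : ClassicalType) (n : ℕ) (t u v : ℂ) : MonoidAlgebra ℂ (weylGroup X n) →ₐ[ℂ] HO X n t u v :=
  MonoidAlgebra.lift ℂ (HO X n t u v) (weylGroup X n) (grp X n t u v)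

/-- The multiplication map `f ⊗ w ⊗ g ↦ f w g`. -/
def mulMap (X : ClassicalType) (n : ℕ) (t u v : ℂ) : SkewPoly n ⊗[ℂ] (MonoidAlgebra ℂ (weylGroup X n) ⊗[ℂ] SkewPoly n) →ₗ[ℂ]
    HO X n t u v :=
  LinearMap.mul' ℂ (HO X n t u v) ∘ₗ TensorProduct.map (xiHom X n t u v).toLinearMap
    (LinearMap.mul' ℂ (HO X n t u v) ∘ₗ
      TensorProduct.map (grpHom X n t u v).toLinearMap (etaHom X n t u v).toLinearMap)

/-- The ordered monomial `b_1 ^ α_1 ⋯ b_n ^ α_n`. -/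
def orderedMonomial {n : ℕ} {R : Type} [Ring R] (b : Fin n → R) (α : Fin n → ℕ) : R :=
  (List.ofFn fun i => b i ^ α i).prod

end OddDaHa

end

noncomputable section

namespace OddDaHa

open scoped TensorProduct

/-! ### Left ideals of quotients of free algebras -/

/-! The plan is to let `HO` act on the space `Triple` of normally ordered expressions so that acting
on `1 ⊗ 1 ⊗ 1` undoes multiplication. This gives injectivity (`tripleRep_mulMap`). The
multiplication map also intertwines this action with left multiplication, so its image is a left
ideal containing `1`, which gives surjectivity.

The space is the module induced from the regular module of `ℂW ⋉ C[η]`, and only the action of `η_i`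
is not obvious. With `κ_ij` the prescribed anticommutator (`bracket`), it must satisfy `η_i ξ_j =
-ξ_j η_i + κ_ij`, a recursion whose consistency is in question because the `ξ_j` anticommute. The
recursion is encoded by triangular operators on pairs (`pairOp`). They anticommute exactly when
`[κ_ij, ξ_k] + [κ_ik, ξ_j] = 0`, which is `bracket_commutator_add`; they then define an action of
`C[ξ]` on pairs, from which `η_i` is read off.

The same identity with `η` in place of `ξ` makes the operators `η_i` anticommute (`opEta_anticomm`).
It is therefore stated for any family `Z` that `W` permutes through `σ ↦ σ^*`. Bases of the factors
come from an explicit action of the skew-polynomial algebra on monomials (`raiseHom`). -/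

/-- In a quotient of a free algebra, a subspace that contains `1` and is stable under left
multiplication by the generators is everything. -/
lemma mem_of_generator_mul_mem {ι R : Type} [Ring R] [Algebra ℂ R] (f : FreeAlgebra ℂ ι →ₐ[ℂ] R)
    (hf : Function.Surjective f) (P : Submodule ℂ R) (h1 : (1 : R) ∈ P)
    (h : ∀ i, ∀ p ∈ P, f (FreeAlgebra.ι ℂ i) * p ∈ P) (a : R) : a ∈ P := by
  obtain ⟨a, rfl⟩ := hf a
  have key : ∀ p ∈ P, f a * p ∈ P := by
    induction a using FreeAlgebra.induction with
    | grade0 r =>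
      intro p hp
      rw [AlgHom.commutes, ← Algebra.smul_def]
      exact P.smul_mem r hp
    | grade1 i => exact h i
    | mul a b ha hb =>
      intro p hp
      rw [map_mul, mul_assoc]
      exact ha _ (hb p hp)
    | add a b ha hb =>
      intro p hp
      rw [map_add, add_mul]
      exact P.add_mem (ha p hp) (hb p hp)
  simpa using key 1 h1

/-! ### Generators and endomorphisms of the skew-polynomial algebra -/

/-- The generator `b_i` of the skew-polynomial algebra. -/
def skewGen {n : ℕ} (i : Fin n) : SkewPoly n :=
  RingQuot.mkAlgHom ℂ (SkewRel n) (FreeAlgebra.ι ℂ i)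

lemma skewGen_anticomm {n : ℕ} (i j : Fin n) (h : i ≠ j) :
    skewGen i * skewGen j + skewGen j * skewGen i = 0 := by
  have := RingQuot.mkAlgHom_rel ℂ (SkewRel.anticomm i j h)
  rwa [map_add, map_mul, map_mul, map_zero] at this

@[simp]
lemma skewLift_skewGen {n : ℕ} {R : Type} [Ring R] [Algebra ℂ R] (b : Fin n → R)
    (hb : ∀ i j, i ≠ j → b i * b j + b j * b i = 0) (i : Fin n) :
    skewLift n b hb (skewGen i) = b i := by
  rw [skewLift, skewGen, RingQuot.liftAlgHom_mkAlgHom_apply, FreeAlgebra.lift_ι_apply]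

lemma mem_of_skewGen_mul_mem {n : ℕ} (P : Submodule ℂ (SkewPoly n)) (h1 : (1 : SkewPoly n) ∈ P)
    (h : ∀ i, ∀ p ∈ P, skewGen i * p ∈ P) (f : SkewPoly n) : f ∈ P :=
  mem_of_generator_mul_mem _ (RingQuot.mkAlgHom_surjective ℂ (SkewRel n)) P h1 h f

/-- The automorphism of the skew-polynomial algebra that permutes the generators. -/
def skewPerm {n : ℕ} (π : Equiv.Perm (Fin n)) : SkewPoly n →ₐ[ℂ] SkewPoly n :=
  skewLift n (fun i => skewGen (π i)) fun _ _ h => skewGen_anticomm _ _ (π.injective.ne h)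

@[simp]
lemma skewPerm_skewGen {n : ℕ} (π : Equiv.Perm (Fin n)) (i : Fin n) :
    skewPerm π (skewGen i) = skewGen (π i) :=
  skewLift_skewGen _ _ i

lemma skewPoly_algHom_ext {n : ℕ} {R : Type} [Ring R] [Algebra ℂ R] {f g : SkewPoly n →ₐ[ℂ] R}
    (h : ∀ i, f (skewGen i) = g (skewGen i)) : f = g := by
  apply RingQuot.ringQuot_ext'
  ext i
  exact h i

@[simp]
lemma skewPerm_one {n : ℕ} : skewPerm (1 : Equiv.Perm (Fin n)) = AlgHom.id ℂ (SkewPoly n) :=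
  skewPoly_algHom_ext fun i => by simp

lemma skewPerm_mul {n : ℕ} (π ρ : Equiv.Perm (Fin n)) :
    skewPerm (π * ρ) = (skewPerm π).comp (skewPerm ρ) :=
  skewPoly_algHom_ext fun i => by simp

/-! ### Ordered monomials -/

/-- The sign that is picked up when `b_i` is moved into its place in `b^α`. -/
def moveSign {n : ℕ} (i : Fin n) (α : Fin n → ℕ) : ℤ := ∏ j, if j < i then (-1) ^ α j else 1

lemma moveSign_mul_self {n : ℕ} (i : Fin n) (α : Fin n → ℕ) :
    moveSign i α * moveSign i α = 1 := by
  rw [moveSign, ← Finset.prod_mul_distrib]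
  refine Finset.prod_eq_one fun j _ => ?_
  split_ifs
  · rw [← mul_pow]; simp
  · simp

/-- An extra factor `b_j` is crossed by `b_i` only when `j < i`. For `i ≠ j` exactly one of `j < i`
and `i < j` holds, so the two orders of insertion differ by one sign; this is what makes the
operators `raise` anticommute. -/
lemma moveSign_add_single {n : ℕ} (i j : Fin n) (α : Fin n → ℕ) :
    moveSign i (α + Pi.single j 1) = (if j < i then -1 else 1) * moveSign i α := by
  have h : ∀ k : Fin n, (if k < i then (-1 : ℤ) ^ (α + Pi.single j 1 : Fin n → ℕ) k else 1) =
      (if k = j then (if j < i then -1 else 1) else 1) * if k < i then (-1) ^ α k else 1 := by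
    intro k
    by_cases hk : k = j
    · subst hk
      by_cases hi : k < i <;> simp [hi, pow_succ]
    · simp [hk]
  rw [moveSign, Finset.prod_congr rfl fun k _ => h k, Finset.prod_mul_distrib,
    Finset.prod_ite_eq' Finset.univ j, moveSign]
  simp

lemma anticomm_pow {R : Type} [Ring R] {a b : R} (h : a * b + b * a = 0) (m : ℕ) :
    a * b ^ m = (-1 : ℤ) ^ m • (b ^ m * a) := by
  have hab : a * b = -(b * a) := eq_neg_of_add_eq_zero_left h
  induction m with
  | zero => simp
  | succ m ih =>
    rw [pow_succ, ← mul_assoc, ih, smul_mul_assoc, mul_assoc, hab, pow_succ, mul_neg, mul_smul,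
      mul_assoc]
    simp

/-- The generator has to cross precisely the powers `b_j ^ α j` with `j < i`. The induction splits
off the first letter: it either absorbs the generator or is crossed by it. -/
lemma generator_mul_orderedMonomial {n : ℕ} {R : Type} [Ring R] (b : Fin n → R)
    (hb : ∀ i j, i ≠ j → b i * b j + b j * b i = 0) (i : Fin n) (α : Fin n → ℕ) :
    b i * orderedMonomial b α = moveSign i α • orderedMonomial b (α + Pi.single i 1) := by
  induction n with
  | zero => exact i.elim0
  | succ n ih =>
    simp only [orderedMonomial, List.ofFn_succ, List.prod_cons] at ih ⊢
    refine Fin.cases ?_ (fun i => ?_) i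
    · simp [moveSign, ← mul_assoc, pow_succ', Fin.succ_ne_zero]
    · have hs : ∀ k : Fin n, (Pi.single i.succ 1 : Fin (n + 1) → ℕ) k.succ =
          (Pi.single i 1 : Fin n → ℕ) k := by
        intro k
        by_cases hk : k = i <;> simp [hk]
      have := ih (fun k => b k.succ) (fun k l h => hb _ _ (by simpa using h)) i
        (fun k => α k.succ)
      rw [← mul_assoc, anticomm_pow (hb _ _ (Fin.succ_ne_zero i)), smul_mul_assoc, mul_assoc,
        this]
      have hz : (Pi.single i.succ 1 : Fin (n + 1) → ℕ) 0 = 0 := by simp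
      simp only [Pi.add_apply, hs, hz, add_zero]
      rw [mul_smul_comm, smul_smul]
      congr 1
      simp [moveSign, Fin.prod_univ_succ]

lemma map_orderedMonomial {n : ℕ} {R R' : Type} [Ring R] [Ring R'] [Algebra ℂ R] [Algebra ℂ R']
    (f : R →ₐ[ℂ] R') (b : Fin n → R) (α : Fin n → ℕ) :
    f (orderedMonomial b α) = orderedMonomial (fun i => f (b i)) α := by
  simp [orderedMonomial, map_list_prod, List.map_ofFn, Function.comp_def]

@[simp]
lemma orderedMonomial_zero {n : ℕ} {R : Type} [Ring R] (b : Fin n → R) :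
    orderedMonomial b 0 = 1 := by
  simp [orderedMonomial]

lemma span_orderedMonomial_skewGen (n : ℕ) :
    Submodule.span ℂ (Set.range (orderedMonomial (skewGen (n := n)))) = ⊤ := by
  refine eq_top_iff.mpr fun f _ => mem_of_skewGen_mul_mem _
    (Submodule.subset_span (Set.mem_range.mpr ⟨0, orderedMonomial_zero _⟩)) (fun i p hp => ?_) f
  induction hp using Submodule.span_induction with
  | mem p hp =>
    obtain ⟨α, rfl⟩ := hp
    rw [generator_mul_orderedMonomial _ skewGen_anticomm]
    exact zsmul_mem (Submodule.subset_span (Set.mem_range_self _)) _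
  | zero => simp
  | add p q _ _ hp hq => rw [mul_add]; exact add_mem hp hq
  | smul c p _ hp => rw [mul_smul_comm]; exact Submodule.smul_mem _ _ hp

/-- The operator by which `b_i` acts on the space with basis the ordered monomials. -/
def raise {n : ℕ} (i : Fin n) : Module.End ℂ ((Fin n → ℕ) →₀ ℂ) :=
  Finsupp.lsum ℂ fun α => (moveSign i α) • Finsupp.lsingle (α + Pi.single i 1)

lemma raise_single {n : ℕ} (i : Fin n) (α : Fin n → ℕ) :
    raise i (Finsupp.single α 1) = moveSign i α • Finsupp.single (α + Pi.single i 1) 1 := by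
  simp [raise]

lemma raise_anticomm {n : ℕ} (i j : Fin n) (h : i ≠ j) :
    raise i * raise j + raise j * raise i = 0 := by
  refine Finsupp.lhom_ext' fun α => LinearMap.ext_ring ?_
  have e : α + Pi.single j 1 + Pi.single i 1 = α + Pi.single i 1 + Pi.single j 1 :=
    add_right_comm _ _ _
  simp only [LinearMap.comp_apply, Finsupp.lsingle_apply, LinearMap.add_apply, Module.End.mul_apply,
    LinearMap.zero_apply, raise_single, map_zsmul, moveSign_add_single, smul_smul, e]
  rw [mul_left_comm, mul_left_comm (moveSign i α), mul_comm (moveSign j α)]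
  rcases lt_or_gt_of_ne h with h | h <;> simp [h, h.not_gt]

/-- The skew-polynomial algebra acts on the space with basis the ordered monomials. -/
def raiseHom (n : ℕ) : SkewPoly n →ₐ[ℂ] Module.End ℂ ((Fin n → ℕ) →₀ ℂ) :=
  skewLift n raise raise_anticomm

/-- The vector indexed by `0` serves as a vacuum: applying monomials to it recovers the standard
basis, whence their linear independence. Induction is on the total degree. -/
lemma raiseHom_orderedMonomial {n : ℕ} (α : Fin n → ℕ) :
    raiseHom n (orderedMonomial skewGen α) (Finsupp.single 0 1) = Finsupp.single α 1 := by
  induction hm : ∑ i, α i generalizing α with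
  | zero =>
    have : α = 0 := funext fun i => by simpa using (Finset.sum_eq_zero_iff.mp hm) i
    simp [this]
  | succ m ih =>
    obtain ⟨i, hi⟩ : ∃ i, α i ≠ 0 := by
      by_contra! h
      simp [h] at hm
    obtain ⟨β, rfl⟩ : ∃ β, α = β + Pi.single i 1 :=
      ⟨α - Pi.single i 1, (tsub_add_cancel_of_le (by
        intro k
        by_cases hk : k = i
        · subst hk; simpa using Nat.one_le_iff_ne_zero.mpr hi
        · simp [hk])).symm⟩
    have hβ : ∑ i, β i = m := by simpa [Finset.sum_add_distrib] using hm
    -- Since the sign is its own inverse, multiplying by it solves the product formula for the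
    -- monomial of exponent `β + e_i`.
    have h := congrArg (fun f => moveSign i β • raiseHom n f (Finsupp.single 0 1))
      (generator_mul_orderedMonomial _ skewGen_anticomm i β)
    simp only [map_mul, Module.End.mul_apply, ih β hβ, map_zsmul, LinearMap.smul_apply,
      smul_smul, moveSign_mul_self, one_smul] at h
    rw [← h, raiseHom, skewLift_skewGen, raise_single, smul_smul, moveSign_mul_self, one_smul]

lemma linearIndependent_orderedMonomial_skewGen (n : ℕ) :
    LinearIndependent ℂ (orderedMonomial (skewGen (n := n))) := by
  refine LinearIndependent.of_comp
    ((LinearMap.applyₗ (Finsupp.single 0 1)).comp (raiseHom n).toLinearMap) ?_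
  convert (Finsupp.basisSingleOne (R := ℂ) (ι := Fin n → ℕ)).linearIndependent using 1
  ext1 α
  simpa using raiseHom_orderedMonomial α

/-- The ordered monomials form a basis of the skew-polynomial algebra. -/
def skewBasis (n : ℕ) : Module.Basis (Fin n → ℕ) ℂ (SkewPoly n) :=
  .mk (linearIndependent_orderedMonomial_skewGen n) (span_orderedMonomial_skewGen n).ge

@[simp]
lemma skewBasis_apply {n : ℕ} (α : Fin n → ℕ) : skewBasis n α = orderedMonomial skewGen α := by
  rw [skewBasis, Module.Basis.mk_apply]

/-- The algebra homomorphism to `ℂ` that kills the generators. -/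
def skewAug (n : ℕ) : SkewPoly n →ₐ[ℂ] ℂ :=
  skewLift n 0 (by simp)

/-! ### The reflection terms in an algebra in which `W` is represented -/

section Reflections

variable {n : ℕ} {R : Type} [Ring R]

/-- The image of `reflTerm X i j` under a representation of `W`. -/
def reflElt : (X : ClassicalType) → (weylGroup X n →* R) → Fin n → Fin n → R
  | .A, Γ, i, j => Γ ⟨transp i j, transp_mem .A i j⟩
  | .B, Γ, i, j => Γ ⟨transp i j, transp_mem .B i j⟩ + Γ ⟨transpBar i j, Subgroup.mem_top _⟩
  | .D, Γ, i, j => Γ ⟨transp i j, transp_mem .D i j⟩ + Γ ⟨transpBar i j, transpBar_mem_D i j⟩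

/-- The image of `shortTerm X i` under a representation of `W`. -/
def shortElt : (X : ClassicalType) → (weylGroup X n →* R) → Fin n → R
  | .B, Γ, i => Γ ⟨signChange i, Subgroup.mem_top _⟩
  | .A, _, _ => 0
  | .D, _, _ => 0

lemma transp_comm (i j : Fin n) : transp i j = transp j i := by
  rw [transp, Equiv.swap_comm, transp]

lemma signChange_mul_comm (i j : Fin n) :
    signChange i * signChange j = signChange j * signChange i := by
  rw [signChange, signChange, ← map_mul, mul_comm, map_mul]

lemma transpBar_comm (i j : Fin n) : transpBar i j = transpBar j i := by
  rw [transpBar, transp_comm, signChange_mul_comm, transpBar]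

lemma signedPerm_mul_signChange (σ : SignedPerm n) (i : Fin n) :
    σ * signChange i = signChange (σ.right i) * σ := by
  ext k
  · simp only [signChange, SemidirectProduct.mul_left, SemidirectProduct.left_inl,
      SemidirectProduct.right_inl, Pi.mul_apply, map_one, MulAut.one_apply, mul_comm (σ.left k)]
    congr 2
    change (Pi.mulSingle i (-1) : Fin n → ℤˣ) (σ.right⁻¹ k) = _
    simp [Pi.mulSingle_apply, Equiv.symm_apply_eq]
  · simp [signChange]

/-- Conjugation by `σ` keeps `s` and `s̄` apart when `σ` gives `i` and `j` equal signs, and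
exchanges them otherwise. This and the next lemmas record the two cases. -/
lemma signedPerm_mul_transp_of_eq (σ : SignedPerm n) {i j : Fin n}
    (h : σ.left (σ.right i) = σ.left (σ.right j)) :
    σ * transp i j = transp (σ.right i) (σ.right j) * σ := by
  ext k
  · simp only [transp, SemidirectProduct.mul_left, SemidirectProduct.left_inr,
      SemidirectProduct.right_inr, Pi.mul_apply, map_one, Pi.one_apply, mul_one, one_mul]
    change _ = ((σ.left ((Equiv.swap (σ.right i) (σ.right j))⁻¹ k) : ℤˣ) : ℤ)
    rw [Equiv.swap_inv, Equiv.swap_apply_def]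
    split_ifs with h1 h2
    · rw [h1, h]
    · rw [h2, h]
    · rfl
  · simp [transp, σ.right.injective.map_swap]

lemma signedPerm_mul_transp_of_ne (σ : SignedPerm n) {i j : Fin n}
    (h : σ.left (σ.right i) ≠ σ.left (σ.right j)) :
    σ * transp i j = transpBar (σ.right i) (σ.right j) * σ := by
  have hij : σ.right i ≠ σ.right j := fun e => h (congrArg _ e)
  have hneg : σ.left (σ.right j) = -σ.left (σ.right i) := by
    rcases Int.units_eq_one_or (σ.left (σ.right i)) with h1 | h1 <;>
    rcases Int.units_eq_one_or (σ.left (σ.right j)) with h2 | h2 <;> simp_all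
  ext k
  · simp only [transpBar, signChange, transp, SemidirectProduct.mul_left, SemidirectProduct.left_inr,
      SemidirectProduct.right_inr, SemidirectProduct.left_inl, SemidirectProduct.right_inl,
      SemidirectProduct.mul_right, Pi.mul_apply, map_one, MulAut.one_apply, Pi.one_apply, mul_one,
      one_mul]
    change _ = (((Pi.mulSingle (σ.right i) (-1) : Fin n → ℤˣ) k *
      (Pi.mulSingle (σ.right j) (-1) : Fin n → ℤˣ) k *
      σ.left ((Equiv.swap (σ.right i) (σ.right j))⁻¹ k) : ℤˣ) : ℤ)
    rw [Equiv.swap_inv, Equiv.swap_apply_def]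
    split_ifs with h1 h2
    · subst h1; simp [hneg, hij]
    · subst h2; simp [hneg, hij.symm]
    · simp [h1, h2]
  · simp [transpBar, signChange, transp, σ.right.injective.map_swap]

lemma signChange_mul_self (i : Fin n) : signChange i * signChange i = 1 := by
  rw [signChange, ← map_mul, ← Pi.mulSingle_mul]
  simp

lemma signedPerm_mul_transpBar (σ : SignedPerm n) (i j : Fin n) :
    σ * transpBar i j =
      signChange (σ.right i) * signChange (σ.right j) * (σ * transp i j) := by
  rw [transpBar, ← mul_assoc, ← mul_assoc, signedPerm_mul_signChange σ i,
    mul_assoc _ σ (signChange j), signedPerm_mul_signChange σ j]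
  simp only [mul_assoc]

lemma signedPerm_mul_transpBar_of_eq (σ : SignedPerm n) {i j : Fin n}
    (h : σ.left (σ.right i) = σ.left (σ.right j)) :
    σ * transpBar i j = transpBar (σ.right i) (σ.right j) * σ := by
  rw [signedPerm_mul_transpBar, signedPerm_mul_transp_of_eq σ h, transpBar]
  simp only [mul_assoc]

lemma signedPerm_mul_transpBar_of_ne (σ : SignedPerm n) {i j : Fin n}
    (h : σ.left (σ.right i) ≠ σ.left (σ.right j)) :
    σ * transpBar i j = transp (σ.right i) (σ.right j) * σ := by
  have hsq : signChange (σ.right i) * signChange (σ.right j) *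
      (signChange (σ.right i) * signChange (σ.right j)) = 1 := by
    rw [(show Commute _ _ from signChange_mul_comm _ _).mul_mul_mul_comm, signChange_mul_self,
      signChange_mul_self, one_mul]
  rw [signedPerm_mul_transpBar, signedPerm_mul_transp_of_ne σ h, transpBar,
    mul_assoc _ _ σ, ← mul_assoc, hsq, one_mul]

lemma reflElt_comm (X : ClassicalType) (Γ : weylGroup X n →* R) (i j : Fin n) :
    reflElt X Γ i j = reflElt X Γ j i := by
  cases X <;> simp only [reflElt, transp_comm i j, transpBar_comm i j]

lemma map_mul_eq_map_mul {X : ClassicalType} (Γ : weylGroup X n →* R) {a b c d : weylGroup X n}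
    (h : (a * b : SignedPerm n) = c * d) : Γ a * Γ b = Γ c * Γ d := by
  rw [← map_mul, ← map_mul]
  exact congrArg Γ (Subtype.ext h)

/-- In types `B` and `D` conjugation may exchange the two kinds of reflection, but their sum is
merely reindexed. In type `A` there are no signs, and a single transposition suffices. -/
lemma grp_mul_reflElt (X : ClassicalType) (Γ : weylGroup X n →* R) (σ : weylGroup X n)
    (i j : Fin n) :
    Γ σ * reflElt X Γ i j = reflElt X Γ (unsign X n σ i) (unsign X n σ j) * Γ σ := by
  by_cases h : (σ : SignedPerm n).left ((σ : SignedPerm n).right i) =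
    (σ : SignedPerm n).left ((σ : SignedPerm n).right j)
  · cases X
    · exact map_mul_eq_map_mul Γ (signedPerm_mul_transp_of_eq _ h)
    all_goals
      simp only [reflElt, mul_add, add_mul]
      exact congrArg₂ _ (map_mul_eq_map_mul Γ (signedPerm_mul_transp_of_eq _ h))
        (map_mul_eq_map_mul Γ (signedPerm_mul_transpBar_of_eq _ h))
  · cases X
    · obtain ⟨_, π, rfl⟩ := σ
      -- All signs of an element of type `A` are trivial, so they cannot differ.
      exact absurd rfl h
    all_goals
      simp only [reflElt, mul_add, add_mul]
      -- The signs differ here, so the two summands change places.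
      rw [add_comm]
      exact congrArg₂ _ (map_mul_eq_map_mul Γ (signedPerm_mul_transpBar_of_ne _ h))
        (map_mul_eq_map_mul Γ (signedPerm_mul_transp_of_ne _ h))

lemma grp_mul_shortElt (X : ClassicalType) (Γ : weylGroup X n →* R) (σ : weylGroup X n)
    (i : Fin n) : Γ σ * shortElt X Γ i = shortElt X Γ (unsign X n σ i) * Γ σ := by
  cases X
  · simp [shortElt]
  · exact map_mul_eq_map_mul Γ (signedPerm_mul_signChange _ _)
  · simp [shortElt]

lemma transpBar_right (i j : Fin n) : (transpBar i j).right = Equiv.swap i j := by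
  simp [transpBar, signChange, transp]

/-- Both `s_{ij}` and `s̄_{ij}` have the swap of `i` and `j` as underlying permutation, so they move
`Z k` in the same way. -/
lemma reflElt_mul {X : ClassicalType} {Γ : weylGroup X n →* R} {Z : Fin n → R}
    (hZ : ∀ σ j, Γ σ * Z j = Z (unsign X n σ j) * Γ σ) (i j k : Fin n) :
    reflElt X Γ i j * Z k = Z (Equiv.swap i j k) * reflElt X Γ i j := by
  have h1 : ∀ h, Γ ⟨transp i j, h⟩ * Z k = Z (Equiv.swap i j k) * Γ ⟨transp i j, h⟩ :=
    fun h => hZ _ _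
  have h2 : ∀ h, Γ ⟨transpBar i j, h⟩ * Z k = Z (Equiv.swap i j k) * Γ ⟨transpBar i j, h⟩ := by
    intro h
    rw [hZ, ← transpBar_right]
    rfl
  cases X
  · exact h1 _
  all_goals
    simp only [reflElt, add_mul, mul_add]
    exact congrArg₂ _ (h1 _) (h2 _)

lemma shortElt_mul {X : ClassicalType} {Γ : weylGroup X n →* R} {Z : Fin n → R}
    (hZ : ∀ σ j, Γ σ * Z j = Z (unsign X n σ j) * Γ σ) (i k : Fin n) :
    shortElt X Γ i * Z k = Z k * shortElt X Γ i := by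
  cases X
  · simp [shortElt]
  · exact hZ _ _
  · simp [shortElt]

variable [Algebra ℂ R]

/-- The value of the anticommutator of `η_i` and `ξ_j`. -/
def bracket (X : ClassicalType) (t u v : ℂ) (Γ : weylGroup X n →* R) (i j : Fin n) : R :=
  if i = j then
    t • 1 + u • (∑ k ∈ Finset.univ.erase i, reflElt X Γ k i) + v • shortElt X Γ i
  else u • reflElt X Γ i j

lemma bracket_comm (X : ClassicalType) (t u v : ℂ) (Γ : weylGroup X n →* R) (i j : Fin n) :
    bracket X t u v Γ i j = bracket X t u v Γ j i := by
  by_cases h : i = j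
  · rw [h]
  · rw [bracket, bracket, if_neg h, if_neg (Ne.symm h), reflElt_comm]

lemma grp_mul_bracket (X : ClassicalType) (t u v : ℂ) (Γ : weylGroup X n →* R)
    (σ : weylGroup X n) (i j : Fin n) :
    Γ σ * bracket X t u v Γ i j =
      bracket X t u v Γ (unsign X n σ i) (unsign X n σ j) * Γ σ := by
  by_cases h : i = j
  · subst h
    simp only [bracket, if_true, mul_add, add_mul, mul_smul_comm, smul_mul_assoc, mul_one, one_mul,
      grp_mul_shortElt, Finset.mul_sum, Finset.sum_mul, grp_mul_reflElt]
    congr 3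
    -- The underlying permutation carries the indices other than `i` to those other than its image.
    exact Finset.sum_equiv (unsign X n σ) (by simp) fun _ _ => rfl
  · simp only [bracket, if_neg h, if_neg ((unsign X n σ).injective.ne h), mul_smul_comm,
      smul_mul_assoc, grp_mul_reflElt]

/-- The scalar, the sign change and all reflections in the sum except the one with `k = j` commute
with `Z j`. -/
lemma bracket_self_mul_sub {X : ClassicalType} (t u v : ℂ) {Γ : weylGroup X n →* R} {Z : Fin n → R}
    (hZ : ∀ σ j, Γ σ * Z j = Z (unsign X n σ j) * Γ σ) {i j : Fin n} (h : i ≠ j) :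
    bracket X t u v Γ i i * Z j - Z j * bracket X t u v Γ i i =
      u • ((Z i - Z j) * reflElt X Γ i j) := by
  have hsum : ∑ k ∈ Finset.univ.erase i, (reflElt X Γ k i * Z j - Z j * reflElt X Γ k i) =
      (Z i - Z j) * reflElt X Γ i j := by
    rw [Finset.sum_eq_single_of_mem j (by simp [h.symm])]
    · rw [reflElt_mul hZ, Equiv.swap_apply_left, sub_mul, reflElt_comm]
    · intro k _ hk
      rw [reflElt_mul hZ, Equiv.swap_apply_of_ne_of_ne hk.symm h.symm, sub_self]
  rw [Finset.sum_sub_distrib, ← Finset.sum_mul, ← Finset.mul_sum] at hsum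
  rw [← hsum, bracket, if_pos rfl, smul_sub]
  simp only [add_mul, mul_add, smul_mul_assoc, mul_smul_comm, one_mul, mul_one, shortElt_mul hZ]
  abel

lemma bracket_ne_mul_sub {X : ClassicalType} (t u v : ℂ) {Γ : weylGroup X n →* R} {Z : Fin n → R}
    (hZ : ∀ σ j, Γ σ * Z j = Z (unsign X n σ j) * Γ σ) {i j : Fin n} (h : i ≠ j) (k : Fin n) :
    bracket X t u v Γ i j * Z k - Z k * bracket X t u v Γ i j =
      u • ((Z (Equiv.swap i j k) - Z k) * reflElt X Γ i j) := by
  rw [bracket, if_neg h, smul_mul_assoc, mul_smul_comm, reflElt_mul hZ, ← smul_sub, sub_mul]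

/-- The compatibility on which the Poincaré–Birkhoff–Witt property rests. -/
lemma bracket_commutator_add {X : ClassicalType} (t u v : ℂ) {Γ : weylGroup X n →* R}
    {Z : Fin n → R} (hZ : ∀ σ j, Γ σ * Z j = Z (unsign X n σ j) * Γ σ) {i j : Fin n} (h : i ≠ j)
    (k : Fin n) :
    (bracket X t u v Γ k i * Z j - Z j * bracket X t u v Γ k i) +
      (bracket X t u v Γ k j * Z i - Z i * bracket X t u v Γ k j) = 0 := by
  -- When `k` is one of the two indices, the commutators are multiples of `(Z i - Z j) s` and `(Z j
  -- - Z i) s` for the same reflection term `s`, and cancel.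
  have hself : ∀ {i j : Fin n}, i ≠ j →
      (bracket X t u v Γ i i * Z j - Z j * bracket X t u v Γ i i) +
        (bracket X t u v Γ i j * Z i - Z i * bracket X t u v Γ i j) = 0 := by
    intro i j h
    rw [bracket_self_mul_sub t u v hZ h, bracket_ne_mul_sub t u v hZ h, Equiv.swap_apply_left,
      ← smul_add, ← add_mul]
    simp
  by_cases hi : k = i
  · subst hi
    exact hself h
  by_cases hj : k = j
  · subst hj
    rw [add_comm]
    exact hself h.symm
  -- For three distinct indices each swap fixes the remaining one, so both commutators vanish
  -- separately.
  rw [bracket_ne_mul_sub t u v hZ hi, bracket_ne_mul_sub t u v hZ hj,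
    Equiv.swap_apply_of_ne_of_ne (Ne.symm hj) h.symm, Equiv.swap_apply_of_ne_of_ne (Ne.symm hi) h]
  simp

end Reflections

/-! ### Induced modules -/

/-- Its addition is reducibly that of `TensorProduct.addCommMonoid`, which does not hold for the
instance that is found by unification through the ring structure of `SkewPoly n`. -/
instance skewTensorAddCommGroup {n : ℕ} {M : Type} [AddCommGroup M] [Module ℂ M] :
    AddCommGroup (SkewPoly n ⊗[ℂ] M) :=
  { TensorProduct.addCommMonoid,
    (TensorProduct.addCommGroup : AddCommGroup (SkewPoly n ⊗[ℂ] M)) with }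

section Induced

variable {n : ℕ} {M : Type} [AddCommGroup M] [Module ℂ M]

/-- The action of `ξ_j` on `C[ξ] ⊗ M`. -/
def opXi (M : Type) [AddCommGroup M] [Module ℂ M] (j : Fin n) :
    Module.End ℂ (SkewPoly n ⊗[ℂ] M) :=
  LinearMap.rTensor M (LinearMap.mulLeft ℂ (skewGen j))

@[simp]
lemma opXi_tmul (j : Fin n) (f : SkewPoly n) (m : M) :
    opXi M j (f ⊗ₜ m) = (skewGen j * f) ⊗ₜ m := rfl

lemma opXi_anticomm (i j : Fin n) (h : i ≠ j) :
    opXi M i * opXi M j + opXi M j * opXi M i = 0 := by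
  refine TensorProduct.ext' fun f m => ?_
  simp only [LinearMap.add_apply, Module.End.mul_apply, opXi_tmul, ← mul_assoc,
    ← TensorProduct.add_tmul, ← add_mul, skewGen_anticomm i j h]
  simp

/-- Two maps out of `C[ξ] ⊗ M` are equal if they agree on `1 ⊗ M` and if their difference satisfies
an exchange relation with the action of each `ξ_k`. -/
lemma tensor_hom_ext {N : Type} [AddCommGroup N] [Module ℂ N] (E F : SkewPoly n ⊗[ℂ] M →ₗ[ℂ] N)
    (T : Fin n → Module.End ℂ N) (hT : ∀ k v, E (opXi M k v) - F (opXi M k v) = T k (E v - F v))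
    (h1 : ∀ m : M, E (1 ⊗ₜ m) = F (1 ⊗ₜ m)) : E = F := by
  refine TensorProduct.ext' fun f m => ?_
  -- For fixed `m`, the `f` at which the maps agree form a subspace containing `1`; it is stable
  -- under the generators because `T k` kills a zero difference.
  let P : Submodule ℂ (SkewPoly n) :=
    LinearMap.ker ((E - F) ∘ₗ (TensorProduct.mk ℂ (SkewPoly n) M).flip m)
  have hf : f ∈ P := by
    refine mem_of_skewGen_mul_mem P ?_ (fun k p hp => ?_) f
    · simp [P, h1]
    · have hp' : E (p ⊗ₜ m) - F (p ⊗ₜ m) = 0 := hp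
      change E ((skewGen k * p) ⊗ₜ m) - F ((skewGen k * p) ⊗ₜ m) = 0
      rw [← opXi_tmul, hT, hp', map_zero]
  exact sub_eq_zero.mp hf

variable {X : ClassicalType}

/-- The action of `W` on `C[ξ] ⊗ M`. -/
def opGrp (ρ : weylGroup X n →* Module.End ℂ M) :
    weylGroup X n →* Module.End ℂ (SkewPoly n ⊗[ℂ] M) where
  toFun σ := TensorProduct.map (skewPerm (unsign X n σ)).toLinearMap (ρ σ)
  map_one' := TensorProduct.ext' fun f m => by simp
  map_mul' σ τ := TensorProduct.ext' fun f m => by simp [skewPerm_mul]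

@[simp]
lemma opGrp_tmul (ρ : weylGroup X n →* Module.End ℂ M) (σ : weylGroup X n) (f : SkewPoly n)
    (m : M) : opGrp ρ σ (f ⊗ₜ m) = skewPerm (unsign X n σ) f ⊗ₜ ρ σ m := rfl

lemma opGrp_mul_opXi (ρ : weylGroup X n →* Module.End ℂ M) (σ : weylGroup X n) (j : Fin n) :
    opGrp ρ σ * opXi M j = opXi M (unsign X n σ j) * opGrp ρ σ :=
  TensorProduct.ext' fun f m => by simp

variable (t u v : ℂ) (ρ : weylGroup X n →* Module.End ℂ M)

/-- The operator `(p, q) ↦ (-ξ_j p + κ q, ξ_j q)`, where `κ` is the anticommutator of `η_i` and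
`ξ_j`. -/
def pairOp (i j : Fin n) :
    Module.End ℂ ((SkewPoly n ⊗[ℂ] M) × (SkewPoly n ⊗[ℂ] M)) :=
  LinearMap.prod
    (-(opXi M j ∘ₗ LinearMap.fst ℂ (SkewPoly n ⊗[ℂ] M) (SkewPoly n ⊗[ℂ] M)) +
      bracket (R := Module.End ℂ (SkewPoly n ⊗[ℂ] M)) X t u v (opGrp ρ) i j ∘ₗ
        LinearMap.snd ℂ (SkewPoly n ⊗[ℂ] M) (SkewPoly n ⊗[ℂ] M))
    (opXi M j ∘ₗ LinearMap.snd ℂ (SkewPoly n ⊗[ℂ] M) (SkewPoly n ⊗[ℂ] M))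

@[simp]
lemma pairOp_apply (i j : Fin n) (p : (SkewPoly n ⊗[ℂ] M) × (SkewPoly n ⊗[ℂ] M)) :
    pairOp t u v ρ i j p =
      (-opXi M j p.1 +
        bracket (R := Module.End ℂ (SkewPoly n ⊗[ℂ] M)) X t u v (opGrp ρ) i j p.2, opXi M j p.2) := rfl

/-- The diagonal entries anticommute because the `ξ` do; the off-diagonal entry of the
anticommutator is the sum of commutators in `bracket_commutator_add`. -/
lemma pairOp_anticomm (i j k : Fin n) (h : j ≠ k) :
    pairOp t u v ρ i j * pairOp t u v ρ i k + pairOp t u v ρ i k * pairOp t u v ρ i j = 0 := by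
  refine LinearMap.ext fun p => ?_
  have h1 := fun q => LinearMap.congr_fun (opXi_anticomm (M := M) j k h) q
  have h2 := LinearMap.congr_fun
    (bracket_commutator_add t u v (opGrp_mul_opXi (M := M) ρ) h i) p.2
  simp only [LinearMap.add_apply, LinearMap.sub_apply, Module.End.mul_apply,
    LinearMap.zero_apply] at h1 h2
  simp only [LinearMap.add_apply, Module.End.mul_apply, pairOp_apply, LinearMap.zero_apply,
    Prod.mk_add_mk, h1, map_add, map_neg]
  refine Prod.ext ?_ rfl
  change _ = (0 : SkewPoly n ⊗[ℂ] M)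
  have key : ∀ {G : Type} [AddCommGroup G] (a b c d e f : G), a + b = 0 →
      c - d + (e - f) = 0 → -(-a + f) + c + (-(-b + d) + e) = 0 := by
    intro G _ a b c d e f h h'
    rw [← h, ← sub_eq_zero, ← h']
    abel
  exact key _ _ _ _ _ _ (h1 p.1) h2

/-- The action of the skew-polynomial algebra by the operators `pairOp`. -/
def pairHom (i : Fin n) :
    SkewPoly n →ₐ[ℂ] Module.End ℂ ((SkewPoly n ⊗[ℂ] M) × (SkewPoly n ⊗[ℂ] M)) :=
  skewLift n (pairOp t u v ρ i) (pairOp_anticomm t u v ρ i)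

variable (h : Fin n → Module.End ℂ M)

/-- The map `f ⊗ m ↦ (η_i (f ⊗ m), f ⊗ m)`. -/
def pairEta (i : Fin n) :
    SkewPoly n ⊗[ℂ] M →ₗ[ℂ] (SkewPoly n ⊗[ℂ] M) × (SkewPoly n ⊗[ℂ] M) :=
  TensorProduct.lift (LinearMap.lcomp ℂ _ (LinearMap.prod
    (TensorProduct.mk ℂ (SkewPoly n) M 1 ∘ₗ h i) (TensorProduct.mk ℂ (SkewPoly n) M 1)) ∘ₗ
      (pairHom t u v ρ i).toLinearMap)

lemma pairEta_tmul (i : Fin n) (f : SkewPoly n) (m : M) :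
    pairEta t u v ρ h i (f ⊗ₜ m) = pairHom t u v ρ i f (1 ⊗ₜ h i m, 1 ⊗ₜ m) := rfl

lemma pairEta_opXi (i j : Fin n) (x : SkewPoly n ⊗[ℂ] M) :
    pairEta t u v ρ h i (opXi M j x) = pairOp t u v ρ i j (pairEta t u v ρ h i x) := by
  suffices pairEta t u v ρ h i ∘ₗ opXi M j = pairOp t u v ρ i j ∘ₗ pairEta t u v ρ h i from
    LinearMap.congr_fun this x
  refine TensorProduct.ext' fun f m => ?_
  simp only [LinearMap.comp_apply, opXi_tmul, pairEta_tmul, map_mul, Module.End.mul_apply]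
  rw [pairHom, skewLift_skewGen]

/-- This ensures that `κ` in the recursion for `η_i` is applied to the original vector. -/
lemma pairEta_snd (i : Fin n) (x : SkewPoly n ⊗[ℂ] M) : (pairEta t u v ρ h i x).2 = x := by
  suffices LinearMap.snd ℂ _ _ ∘ₗ pairEta t u v ρ h i = LinearMap.id from
    LinearMap.congr_fun this x
  refine tensor_hom_ext _ _ (opXi M) (fun k y => ?_) fun m => ?_
  · simp [pairEta_opXi]
  · simp [pairEta_tmul]

/-- The action of `η_i` on `C[ξ] ⊗ M`. -/
def opEta (i : Fin n) : Module.End ℂ (SkewPoly n ⊗[ℂ] M) :=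
  LinearMap.fst ℂ _ _ ∘ₗ pairEta t u v ρ h i

lemma opEta_one_tmul (i : Fin n) (m : M) :
    opEta t u v ρ h i (1 ⊗ₜ m) = 1 ⊗ₜ h i m := by
  simp [opEta, pairEta_tmul]

lemma opEta_opXi (i j : Fin n) (x : SkewPoly n ⊗[ℂ] M) :
    opEta t u v ρ h i (opXi M j x) =
      -opXi M j (opEta t u v ρ h i x) +
        bracket (R := Module.End ℂ (SkewPoly n ⊗[ℂ] M)) X t u v (opGrp ρ) i j x := by
  simp [opEta, pairEta_opXi, pairEta_snd]

/-- Moving both sides past `ξ_k` produces the same `κ` terms by `grp_mul_bracket`, so only the base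
case `1 ⊗ m` has content, and that is `hh`. -/
lemma opGrp_mul_opEta (hh : ∀ σ j, ρ σ * h j = h (unsign X n σ j) * ρ σ) (σ : weylGroup X n)
    (j : Fin n) :
    opGrp ρ σ * opEta t u v ρ h j = opEta t u v ρ h (unsign X n σ j) * opGrp ρ σ := by
  refine tensor_hom_ext _ _ (fun k => -opXi M (unsign X n σ k)) (fun k x => ?_) fun m => ?_
  · have h1 := fun k x => LinearMap.congr_fun (opGrp_mul_opXi (M := M) ρ σ k) x
    have h2 := LinearMap.congr_fun (grp_mul_bracket X t u v (opGrp ρ) σ j k) x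
    simp only [Module.End.mul_apply] at h1 h2
    simp only [Module.End.mul_apply, opEta_opXi, h1, h2, map_add, map_neg, map_sub,
      LinearMap.neg_apply]
    abel
  · simpa [opEta_one_tmul] using
      congrArg (fun y => (1 : SkewPoly n) ⊗ₜ[ℂ] y) (LinearMap.congr_fun (hh σ j) m)

/-- Moving the anticommutator past `ξ_k` leaves the error `-[κ_ik, η_j] - [κ_jk, η_i]`. It vanishes
by `bracket_commutator_add` with `Z` the family of operators `η`, as `W` is already known to permute
them. -/
lemma opEta_anticomm (hh : ∀ σ j, ρ σ * h j = h (unsign X n σ j) * ρ σ)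
    (ha : ∀ i j, i ≠ j → h i * h j + h j * h i = 0) (i j : Fin n) (hij : i ≠ j) :
    opEta t u v ρ h i * opEta t u v ρ h j + opEta t u v ρ h j * opEta t u v ρ h i = 0 := by
  refine tensor_hom_ext _ _ (opXi M) (fun k x => ?_) fun m => ?_
  · have h2 := LinearMap.congr_fun
      (bracket_commutator_add t u v (opGrp_mul_opEta t u v ρ h hh) hij k) x
    rw [bracket_comm _ _ _ _ _ k i, bracket_comm _ _ _ _ _ k j] at h2
    simp only [LinearMap.add_apply, LinearMap.sub_apply, Module.End.mul_apply,
      LinearMap.zero_apply] at h2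
    simp only [LinearMap.add_apply, Module.End.mul_apply, opEta_opXi, map_add, map_neg, sub_zero,
      LinearMap.zero_apply]
    rw [← sub_eq_zero, ← neg_eq_zero, ← h2]
    abel
  · have := LinearMap.congr_fun (ha i j hij) m
    simp only [LinearMap.add_apply, Module.End.mul_apply, LinearMap.zero_apply] at this
    simp [opEta_one_tmul, ← TensorProduct.tmul_add, this]

end Induced

/-! ### The regular module of `ℂW ⋉ C[η]` -/

section Regular

variable {X : ClassicalType} {n : ℕ}

/-- The counterpart of `skewTensorAddCommGroup` for `ℂW ⊗ C[η]`. -/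
instance grpTensorAddCommGroup :
    AddCommGroup (MonoidAlgebra ℂ (weylGroup X n) ⊗[ℂ] SkewPoly n) :=
  { TensorProduct.addCommMonoid,
    (TensorProduct.addCommGroup :
      AddCommGroup (MonoidAlgebra ℂ (weylGroup X n) ⊗[ℂ] SkewPoly n)) with }

/-- The action of `W` on `ℂW ⊗ C[η]`. -/
def regGrp (X : ClassicalType) (n : ℕ) :
    weylGroup X n →* Module.End ℂ (MonoidAlgebra ℂ (weylGroup X n) ⊗[ℂ] SkewPoly n) where
  toFun σ := LinearMap.rTensor _ (LinearMap.mulLeft ℂ (MonoidAlgebra.of ℂ _ σ))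
  map_one' := TensorProduct.ext' fun w g => by simp [← MonoidAlgebra.one_def]
  map_mul' σ τ := TensorProduct.ext' fun w g => by
    simp only [LinearMap.rTensor_tmul, LinearMap.mulLeft_apply, Module.End.mul_apply, map_mul,
      mul_assoc]

lemma regGrp_tmul (σ : weylGroup X n) (w : MonoidAlgebra ℂ (weylGroup X n)) (g : SkewPoly n) :
    regGrp X n σ (w ⊗ₜ g) = (MonoidAlgebra.of ℂ _ σ * w) ⊗ₜ g := rfl

/-- The action of `η_j` on `ℂW ⊗ C[η]`. -/
def regEta (X : ClassicalType) (n : ℕ) (j : Fin n) :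
    Module.End ℂ (MonoidAlgebra ℂ (weylGroup X n) ⊗[ℂ] SkewPoly n) :=
  -- The inverse appears because `η_j σ = σ η_k` with `k = (σ^*)⁻¹ j`.
  TensorProduct.lift ((MonoidAlgebra.basis (weylGroup X n) ℂ).constr ℂ fun σ =>
    TensorProduct.mk ℂ _ _ (MonoidAlgebra.of ℂ _ σ) ∘ₗ
      LinearMap.mulLeft ℂ (skewGen ((unsign X n σ)⁻¹ j)))

lemma regEta_tmul (j : Fin n) (σ : weylGroup X n) (g : SkewPoly n) :
    regEta X n j (MonoidAlgebra.of ℂ _ σ ⊗ₜ g) =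
      MonoidAlgebra.of ℂ _ σ ⊗ₜ (skewGen ((unsign X n σ)⁻¹ j) * g) := by
  have : MonoidAlgebra.of ℂ _ σ = MonoidAlgebra.basis (weylGroup X n) ℂ σ := by simp
  rw [regEta, TensorProduct.lift.tmul, this, Module.Basis.constr_basis]
  simp

lemma regular_hom_ext {N : Type} [AddCommMonoid N] [Module ℂ N]
    {E F : MonoidAlgebra ℂ (weylGroup X n) ⊗[ℂ] SkewPoly n →ₗ[ℂ] N}
    (h : ∀ σ g, E (MonoidAlgebra.of ℂ _ σ ⊗ₜ g) = F (MonoidAlgebra.of ℂ _ σ ⊗ₜ g)) : E = F := by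
  refine TensorProduct.ext ((MonoidAlgebra.basis (weylGroup X n) ℂ).ext fun σ => ?_)
  refine LinearMap.ext fun g => ?_
  simpa using h σ g

lemma regGrp_mul_regEta (σ : weylGroup X n) (j : Fin n) :
    regGrp X n σ * regEta X n j = regEta X n (unsign X n σ j) * regGrp X n σ := by
  refine regular_hom_ext fun τ g => ?_
  simp only [Module.End.mul_apply, regEta_tmul, regGrp_tmul, ← map_mul]
  simp

lemma regEta_anticomm (i j : Fin n) (h : i ≠ j) :
    regEta X n i * regEta X n j + regEta X n j * regEta X n i = 0 := by
  refine regular_hom_ext fun τ g => ?_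
  simp only [LinearMap.add_apply, Module.End.mul_apply, regEta_tmul, ← TensorProduct.tmul_add,
    ← mul_assoc, ← add_mul]
  rw [skewGen_anticomm _ _ ((Equiv.injective _).ne h)]
  simp

lemma regEta_one_tmul (j : Fin n) (g : SkewPoly n) :
    regEta X n j (1 ⊗ₜ g) = 1 ⊗ₜ (skewGen j * g) := by
  simpa [← MonoidAlgebra.one_def] using regEta_tmul (X := X) j 1 g

end Regular

/-! ### The polynomial representation of the odd double affine Hecke algebra -/

section Representation

variable (X : ClassicalType) (n : ℕ) (t u v : ℂ)

/-- The space `C[ξ] ⊗ ℂW ⊗ C[η]`. -/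
abbrev Triple (X : ClassicalType) (n : ℕ) : Type :=
  SkewPoly n ⊗[ℂ] (MonoidAlgebra ℂ (weylGroup X n) ⊗[ℂ] SkewPoly n)

lemma lift_reflTerm {X : ClassicalType} {n : ℕ} {R : Type} [Ring R] [Algebra ℂ R]
    (φ : Free X n →ₐ[ℂ] R) (Γ : weylGroup X n →* R) (h : ∀ σ, φ (fgrp σ) = Γ σ) (i j : Fin n) :
    φ (reflTerm X i j) = reflElt X Γ i j := by
  cases X <;> simp only [reflTerm, reflElt, map_add, h]

lemma lift_shortTerm {X : ClassicalType} {n : ℕ} {R : Type} [Ring R] [Algebra ℂ R]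
    (φ : Free X n →ₐ[ℂ] R) (Γ : weylGroup X n →* R) (h : ∀ σ, φ (fgrp σ) = Γ σ) (i : Fin n) :
    φ (shortTerm X i) = shortElt X Γ i := by
  cases X <;> simp only [shortTerm, shortElt, map_zero, h]

/-- The algebra homomorphism out of the odd double affine Hecke algebra given by elements that
satisfy the defining relations. -/
def liftHO {R : Type} [Ring R] [Algebra ℂ R] (x y : Fin n → R) (Γ : weylGroup X n →* R)
    (hx : ∀ i j, i ≠ j → x i * x j + x j * x i = 0)
    (hy : ∀ i j, i ≠ j → y i * y j + y j * y i = 0)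
    (hΓx : ∀ σ j, Γ σ * x j = x (unsign X n σ j) * Γ σ)
    (hΓy : ∀ σ j, Γ σ * y j = y (unsign X n σ j) * Γ σ)
    (hyx : ∀ i j, y i * x j + x j * y i = bracket X t u v Γ i j) : HO X n t u v →ₐ[ℂ] R :=
  RingQuot.liftAlgHom ℂ ⟨FreeAlgebra.lift ℂ fun g => match g with
    | .xi i => x i
    | .eta i => y i
    | .grp σ => Γ σ, by
    set φ : Free X n →ₐ[ℂ] R := FreeAlgebra.lift ℂ _ with hφ
    have hgrp : ∀ σ, φ (fgrp σ) = Γ σ := fun σ => FreeAlgebra.lift_ι_apply _ _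
    have hxi : ∀ i, φ (fxi i) = x i := fun i => FreeAlgebra.lift_ι_apply _ _
    have heta : ∀ i, φ (feta i) = y i := fun i => FreeAlgebra.lift_ι_apply _ _
    clear_value φ
    rintro _ _ (_ | ⟨σ, τ⟩ | ⟨i, j, h⟩ | ⟨i, j, h⟩ | ⟨σ, j⟩ | ⟨σ, j⟩ | ⟨i, j, h⟩ | i)
    · rw [hgrp, map_one, map_one]
    · rw [map_mul, hgrp, hgrp, hgrp, map_mul]
    · rw [map_neg, map_mul, map_mul, heta, heta, eq_neg_iff_add_eq_zero, hy i j h]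
    · rw [map_neg, map_mul, map_mul, hxi, hxi, eq_neg_iff_add_eq_zero, hx i j h]
    · rw [map_mul, map_mul, hgrp, hxi, hxi, hΓx]
    · rw [map_mul, map_mul, hgrp, heta, heta, hΓy]
    · rw [map_add, map_mul, map_mul, heta, hxi, hyx, bracket, if_neg h, map_smul,
        lift_reflTerm φ Γ hgrp]
    · simp only [map_add, map_mul, heta, hxi, hyx, bracket, if_true, map_smul, map_one, map_sum,
        lift_reflTerm φ Γ hgrp, lift_shortTerm φ Γ hgrp]⟩

section liftHO

variable {X n t u v} {R : Type} [Ring R] [Algebra ℂ R] (x y : Fin n → R) (Γ : weylGroup X n →* R)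
    (hx : ∀ i j, i ≠ j → x i * x j + x j * x i = 0)
    (hy : ∀ i j, i ≠ j → y i * y j + y j * y i = 0)
    (hΓx : ∀ σ j, Γ σ * x j = x (unsign X n σ j) * Γ σ)
    (hΓy : ∀ σ j, Γ σ * y j = y (unsign X n σ j) * Γ σ)
    (hyx : ∀ i j, y i * x j + x j * y i = bracket X t u v Γ i j)

lemma liftHO_xi (i : Fin n) :
    liftHO X n t u v x y Γ hx hy hΓx hΓy hyx (xi X n t u v i) = x i := by
  rw [liftHO, xi, RingQuot.liftAlgHom_mkAlgHom_apply]
  exact FreeAlgebra.lift_ι_apply _ _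

lemma liftHO_eta (i : Fin n) :
    liftHO X n t u v x y Γ hx hy hΓx hΓy hyx (eta X n t u v i) = y i := by
  rw [liftHO, eta, RingQuot.liftAlgHom_mkAlgHom_apply]
  exact FreeAlgebra.lift_ι_apply _ _

lemma liftHO_grp (σ : weylGroup X n) :
    liftHO X n t u v x y Γ hx hy hΓx hΓy hyx (grp X n t u v σ) = Γ σ := by
  change liftHO X n t u v x y Γ hx hy hΓx hΓy hyx (RingQuot.mkAlgHom ℂ _ (fgrp σ)) = Γ σ
  rw [liftHO, RingQuot.liftAlgHom_mkAlgHom_apply]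
  exact FreeAlgebra.lift_ι_apply _ _

end liftHO

lemma grp_mul_xi (σ : weylGroup X n) (j : Fin n) :
    grp X n t u v σ * xi X n t u v j = xi X n t u v (unsign X n σ j) * grp X n t u v σ := by
  have := RingQuot.mkAlgHom_rel ℂ (HORel.grp_xi (t := t) (u := u) (v := v) σ j)
  rwa [map_mul, map_mul] at this

lemma grp_mul_eta (σ : weylGroup X n) (j : Fin n) :
    grp X n t u v σ * eta X n t u v j = eta X n t u v (unsign X n σ j) * grp X n t u v σ := by
  have := RingQuot.mkAlgHom_rel ℂ (HORel.grp_eta (t := t) (u := u) (v := v) σ j)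
  rwa [map_mul, map_mul] at this

lemma eta_mul_xi_add (i j : Fin n) :
    eta X n t u v i * xi X n t u v j + xi X n t u v j * eta X n t u v i =
      bracket X t u v (grp X n t u v) i j := by
  have hgrp : ∀ σ, RingQuot.mkAlgHom ℂ (HORel X n t u v) (fgrp σ) = grp X n t u v σ :=
    fun _ => rfl
  by_cases h : i = j
  · subst h
    have := RingQuot.mkAlgHom_rel ℂ (HORel.eta_xi_self (X := X) (t := t) (u := u) (v := v) i)
    simp only [map_add, map_mul, map_smul, map_one, map_sum, lift_reflTerm _ _ hgrp,
      lift_shortTerm _ _ hgrp] at this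
    rw [bracket, if_pos rfl]
    exact this
  · have := RingQuot.mkAlgHom_rel ℂ (HORel.eta_xi_ne (X := X) (t := t) (u := u) (v := v) i j h)
    rw [map_add, map_mul, map_mul, map_smul, lift_reflTerm _ _ hgrp] at this
    rw [bracket, if_neg h]
    exact this

/-- The action of `W` on `C[ξ] ⊗ ℂW ⊗ C[η]`. -/
def tripleGrp : weylGroup X n →* Module.End ℂ (Triple X n) := opGrp (regGrp X n)

/-- The action of `η_i` on `C[ξ] ⊗ ℂW ⊗ C[η]`. -/
def tripleEta (i : Fin n) : Module.End ℂ (Triple X n) := opEta t u v (regGrp X n) (regEta X n) i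

/-- The representation of the odd double affine Hecke algebra on `C[ξ] ⊗ ℂW ⊗ C[η]`. -/
def tripleRep : HO X n t u v →ₐ[ℂ] Module.End ℂ (Triple X n) :=
  liftHO X n t u v (opXi _) (tripleEta X n t u v) (tripleGrp X n) opXi_anticomm
    (opEta_anticomm t u v _ _ regGrp_mul_regEta regEta_anticomm)
    (opGrp_mul_opXi _) (opGrp_mul_opEta t u v _ _ regGrp_mul_regEta)
    fun i j => LinearMap.ext fun x => by
      simp only [LinearMap.add_apply, Module.End.mul_apply, tripleEta, opEta_opXi, tripleGrp]
      exact neg_add_cancel_comm (G := Triple X n) _ _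

lemma tripleRep_xi (i : Fin n) : tripleRep X n t u v (xi X n t u v i) = opXi _ i :=
  liftHO_xi ..

lemma tripleRep_eta (i : Fin n) :
    tripleRep X n t u v (eta X n t u v i) = tripleEta X n t u v i :=
  liftHO_eta ..

lemma tripleRep_grp (σ : weylGroup X n) :
    tripleRep X n t u v (grp X n t u v σ) = tripleGrp X n σ :=
  liftHO_grp ..

lemma xiHom_skewGen (i : Fin n) : xiHom X n t u v (skewGen i) = xi X n t u v i :=
  skewLift_skewGen _ _ i

lemma etaHom_skewGen (i : Fin n) : etaHom X n t u v (skewGen i) = eta X n t u v i :=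
  skewLift_skewGen _ _ i

lemma grpHom_of (σ : weylGroup X n) :
    grpHom X n t u v (MonoidAlgebra.of ℂ _ σ) = grp X n t u v σ :=
  MonoidAlgebra.lift_of _ _

lemma mulMap_tmul (f : SkewPoly n) (w : MonoidAlgebra ℂ (weylGroup X n)) (g : SkewPoly n) :
    mulMap X n t u v (f ⊗ₜ (w ⊗ₜ g)) =
      xiHom X n t u v f * (grpHom X n t u v w * etaHom X n t u v g) := rfl

/-! ### Injectivity of the multiplication map -/

lemma tripleRep_xiHom (f p : SkewPoly n) (m : MonoidAlgebra ℂ (weylGroup X n) ⊗[ℂ] SkewPoly n) :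
    tripleRep X n t u v (xiHom X n t u v f) (p ⊗ₜ m) = (f * p) ⊗ₜ m := by
  let P : Submodule ℂ (SkewPoly n) := LinearMap.eqLocus
    ((LinearMap.applyₗ (p ⊗ₜ m)).comp ((tripleRep X n t u v).comp (xiHom X n t u v)).toLinearMap)
    ((TensorProduct.mk ℂ _ _).flip m ∘ₗ LinearMap.mulRight ℂ p)
  have hP : ∀ f, f ∈ P ↔
      tripleRep X n t u v (xiHom X n t u v f) (p ⊗ₜ m) = (f * p) ⊗ₜ m :=
    fun _ => Iff.rfl
  refine (hP f).mp (mem_of_skewGen_mul_mem P ?_ (fun k q hq => ?_) f)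
  · rw [hP, map_one, map_one, one_mul, Module.End.one_apply]
  · rw [hP] at hq ⊢
    rw [map_mul, map_mul, Module.End.mul_apply, hq, xiHom_skewGen, tripleRep_xi,
      opXi_tmul, mul_assoc]

/-- With `1` in the first factor no `κ` terms arise, and with `1` in the second no index is
permuted. -/
lemma tripleRep_etaHom (g q : SkewPoly n) :
    tripleRep X n t u v (etaHom X n t u v g) (1 ⊗ₜ (1 ⊗ₜ q)) = 1 ⊗ₜ (1 ⊗ₜ (g * q)) := by
  let P : Submodule ℂ (SkewPoly n) := LinearMap.eqLocus
    ((LinearMap.applyₗ (1 ⊗ₜ (1 ⊗ₜ q))).comp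
      ((tripleRep X n t u v).comp (etaHom X n t u v)).toLinearMap)
    (TensorProduct.mk ℂ (SkewPoly n) (MonoidAlgebra ℂ (weylGroup X n) ⊗[ℂ] SkewPoly n) 1 ∘ₗ
      TensorProduct.mk ℂ (MonoidAlgebra ℂ (weylGroup X n)) (SkewPoly n) 1 ∘ₗ
        LinearMap.mulRight ℂ q)
  have hP : ∀ g, g ∈ P ↔
      tripleRep X n t u v (etaHom X n t u v g) (1 ⊗ₜ (1 ⊗ₜ q)) = 1 ⊗ₜ (1 ⊗ₜ (g * q)) :=
    fun _ => Iff.rfl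
  refine (hP g).mp (mem_of_skewGen_mul_mem P ?_ (fun k p hp => ?_) g)
  · rw [hP, map_one, map_one, one_mul, Module.End.one_apply]
  · rw [hP] at hp ⊢
    rw [map_mul, map_mul, Module.End.mul_apply, hp, etaHom_skewGen, tripleRep_eta,
      tripleEta, opEta_one_tmul, regEta_one_tmul, mul_assoc]

/-- Acting on `1 ⊗ 1 ⊗ 1` is a left inverse of the multiplication map. -/
lemma tripleRep_mulMap (x : Triple X n) :
    tripleRep X n t u v (mulMap X n t u v x) (1 ⊗ₜ (1 ⊗ₜ 1)) = x := by
  suffices ((LinearMap.applyₗ (1 ⊗ₜ (1 ⊗ₜ 1))).comp (tripleRep X n t u v).toLinearMap) ∘ₗ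
      mulMap X n t u v = LinearMap.id from LinearMap.congr_fun this x
  refine TensorProduct.ext (LinearMap.ext fun f => regular_hom_ext fun σ g => ?_)
  change tripleRep X n t u v (mulMap X n t u v (f ⊗ₜ (MonoidAlgebra.of ℂ _ σ ⊗ₜ g)))
    (1 ⊗ₜ (1 ⊗ₜ 1)) = f ⊗ₜ (MonoidAlgebra.of ℂ _ σ ⊗ₜ g)
  -- Acting from right to left, `g` fills the third factor, `σ` the second (it fixes `1` in the
  -- first), and `f` the first.
  rw [mulMap_tmul, map_mul, map_mul, Module.End.mul_apply, Module.End.mul_apply, tripleRep_etaHom,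
    grpHom_of, mul_one]
  rw [tripleRep_grp, tripleGrp, opGrp_tmul, regGrp_tmul, map_one, tripleRep_xiHom, mul_one, mul_one]

lemma mulMap_injective : Function.Injective (mulMap X n t u v) :=
  Function.LeftInverse.injective
    (g := fun a => tripleRep X n t u v a (1 ⊗ₜ (1 ⊗ₜ 1))) (tripleRep_mulMap X n t u v)

/-! ### Surjectivity of the multiplication map -/

lemma mulMap_opXi (i : Fin n) (x : Triple X n) :
    mulMap X n t u v (opXi _ i x) = xi X n t u v i * mulMap X n t u v x := by
  suffices mulMap X n t u v ∘ₗ opXi _ i =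
      LinearMap.mulLeft ℂ (xi X n t u v i) ∘ₗ mulMap X n t u v from LinearMap.congr_fun this x
  refine TensorProduct.ext (LinearMap.ext fun f => TensorProduct.ext' fun w g => ?_)
  change mulMap X n t u v ((skewGen i * f) ⊗ₜ (w ⊗ₜ g)) =
    xi X n t u v i * mulMap X n t u v (f ⊗ₜ (w ⊗ₜ g))
  rw [mulMap_tmul, mulMap_tmul, map_mul, xiHom_skewGen, mul_assoc]

lemma mulMap_tripleGrp (σ : weylGroup X n) (x : Triple X n) :
    mulMap X n t u v (tripleGrp X n σ x) = grp X n t u v σ * mulMap X n t u v x := by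
  suffices mulMap X n t u v ∘ₗ tripleGrp X n σ =
      LinearMap.mulLeft ℂ (grp X n t u v σ) ∘ₗ mulMap X n t u v from LinearMap.congr_fun this x
  refine tensor_hom_ext _ _ (fun k => LinearMap.mulLeft ℂ (xi X n t u v (unsign X n σ k)))
    (fun k y => ?_) fun m => ?_
  · have h1 := LinearMap.congr_fun (opGrp_mul_opXi (regGrp X n) σ k) y
    simp only [Module.End.mul_apply] at h1
    simp only [LinearMap.comp_apply, LinearMap.mulLeft_apply, tripleGrp, h1, mulMap_opXi,
      mul_sub, ← mul_assoc, grp_mul_xi]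
  · induction m using TensorProduct.induction_on with
    | zero => simp
    | tmul w g =>
      simp only [LinearMap.comp_apply, tripleGrp, opGrp_tmul, regGrp_tmul, mulMap_tmul,
        LinearMap.mulLeft_apply, map_mul, map_one, one_mul, grpHom_of, mul_assoc]
    | add a b ha hb => rw [TensorProduct.tmul_add, map_add, map_add, ha, hb]

/-- The anticommutator is a linear combination of group elements, so a linear map that intertwines
`W` intertwines it too. -/
lemma map_bracket {X : ClassicalType} {n : ℕ} (t u v : ℂ) {V R : Type} [AddCommGroup V] [Module ℂ V]
    [Ring R] [Algebra ℂ R] (φ : V →ₗ[ℂ] R) (Γ : weylGroup X n →* Module.End ℂ V)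
    (Δ : weylGroup X n →* R) (h : ∀ σ x, φ (Γ σ x) = Δ σ * φ x) (i j : Fin n) (x : V) :
    φ (bracket X t u v Γ i j x) = bracket X t u v Δ i j * φ x := by
  have hr : ∀ i j, φ (reflElt X Γ i j x) = reflElt X Δ i j * φ x := by
    intro i j
    cases X <;> simp only [reflElt, LinearMap.add_apply, map_add, h, add_mul]
  have hs : ∀ i, φ (shortElt X Γ i x) = shortElt X Δ i * φ x := by
    intro i
    cases X <;> simp only [shortElt, LinearMap.zero_apply, map_zero, h, zero_mul]
  unfold bracket
  split_ifs
  · simp only [LinearMap.add_apply, LinearMap.smul_apply, Module.End.one_apply,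
      LinearMap.sum_apply, map_add, map_smul, map_sum, hr, hs, add_mul, smul_mul_assoc, one_mul,
      Finset.sum_mul]
  · simp [hr]

/-- Both sides obey the recursion `η_i ξ_k = -ξ_k η_i + κ_ik`, on the left by construction and on
the right by the relations of `HO`. They agree on `1 ⊗ σ ⊗ g`, where `η_i` only crosses `σ`. -/
lemma mulMap_tripleEta (i : Fin n) (x : Triple X n) :
    mulMap X n t u v (tripleEta X n t u v i x) = eta X n t u v i * mulMap X n t u v x := by
  suffices mulMap X n t u v ∘ₗ tripleEta X n t u v i =
      LinearMap.mulLeft ℂ (eta X n t u v i) ∘ₗ mulMap X n t u v from LinearMap.congr_fun this x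
  refine tensor_hom_ext _ _ (fun k => -LinearMap.mulLeft ℂ (xi X n t u v k))
    (fun k y => ?_) fun m => ?_
  · have h1 := eta_mul_xi_add X n t u v i k
    have h2 := map_bracket t u v (mulMap X n t u v) (tripleGrp X n) (grp X n t u v)
      (mulMap_tripleGrp X n t u v) i k y
    have h3 : ∀ z, mulMap X n t u v (-z) = -mulMap X n t u v z := fun z =>
      LinearMap.map_neg (mulMap X n t u v) z
    rw [tripleGrp] at h2
    simp only [LinearMap.comp_apply, LinearMap.mulLeft_apply, tripleEta, opEta_opXi, mulMap_opXi,
      map_add, h3, h2, ← h1, LinearMap.neg_apply, add_mul, mul_sub, mul_assoc]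
    abel
  · suffices mulMap X n t u v ∘ₗ tripleEta X n t u v i ∘ₗ TensorProduct.mk ℂ _ _ 1 =
        LinearMap.mulLeft ℂ (eta X n t u v i) ∘ₗ mulMap X n t u v ∘ₗ TensorProduct.mk ℂ _ _ 1 from
      LinearMap.congr_fun this m
    refine regular_hom_ext fun σ g => ?_
    simp only [LinearMap.comp_apply, TensorProduct.mk_apply, tripleEta, opEta_one_tmul,
      regEta_tmul, mulMap_tmul, LinearMap.mulLeft_apply, map_mul, map_one, one_mul, grpHom_of,
      etaHom_skewGen]
    rw [← mul_assoc, grp_mul_eta, mul_assoc]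
    simp

lemma mulMap_surjective : Function.Surjective (mulMap X n t u v) := by
  intro a
  refine mem_of_generator_mul_mem _ (RingQuot.mkAlgHom_surjective ℂ (HORel X n t u v))
    (LinearMap.range (mulMap X n t u v)) ⟨1 ⊗ₜ (1 ⊗ₜ 1), by simp [mulMap_tmul]⟩ ?_ a
  rintro (i | i | σ) _ ⟨x, rfl⟩
  · exact ⟨_, mulMap_opXi X n t u v i x⟩
  · exact ⟨_, mulMap_tripleEta X n t u v i x⟩
  · exact ⟨_, mulMap_tripleGrp X n t u v σ x⟩

lemma mulMap_bijective : Function.Bijective (mulMap X n t u v) :=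
  ⟨mulMap_injective X n t u v, mulMap_surjective X n t u v⟩

/-! ### Consequences -/

/-- The augmentation of the group algebra. -/
def grpAug (X : ClassicalType) (n : ℕ) : MonoidAlgebra ℂ (weylGroup X n) →ₐ[ℂ] ℂ :=
  MonoidAlgebra.lift ℂ ℂ _ 1

lemma xiHom_injective : Function.Injective (xiHom X n t u v) := by
  have hinj : Function.Injective fun f : SkewPoly n =>
      (f ⊗ₜ (1 ⊗ₜ 1) : Triple X n) :=
    -- The augmentations of the other two factors retract onto the first.
    Function.LeftInverse.injective (g := TensorProduct.rid ℂ _ ∘ LinearMap.lTensor (SkewPoly n)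
      (LinearMap.mul' ℂ ℂ ∘ₗ TensorProduct.map (grpAug X n).toLinearMap (skewAug n).toLinearMap))
      fun f => by simp
  convert (mulMap_injective X n t u v).comp hinj using 1
  ext f
  simp [mulMap_tmul]

lemma etaHom_injective : Function.Injective (etaHom X n t u v) := by
  have hinj : Function.Injective fun g : SkewPoly n => (1 ⊗ₜ (1 ⊗ₜ g) : Triple X n) :=
    Function.LeftInverse.injective (g := TensorProduct.lid ℂ _ ∘ TensorProduct.map
      (skewAug n).toLinearMap ((TensorProduct.lid ℂ (SkewPoly n)).toLinearMap ∘ₗ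
        LinearMap.rTensor (SkewPoly n) (grpAug X n).toLinearMap))
      fun f => by simp
  convert (mulMap_injective X n t u v).comp hinj using 1
  ext f
  simp [mulMap_tmul]

lemma grpHom_injective : Function.Injective (grpHom X n t u v) := by
  have hinj : Function.Injective fun w : MonoidAlgebra ℂ (weylGroup X n) =>
      (1 ⊗ₜ (w ⊗ₜ 1) : Triple X n) :=
    Function.LeftInverse.injective (g := TensorProduct.lid ℂ _ ∘ TensorProduct.map
      (skewAug n).toLinearMap ((TensorProduct.rid ℂ _).toLinearMap ∘ₗ
        LinearMap.lTensor _ (skewAug n).toLinearMap))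
      fun f => by simp
  convert (mulMap_injective X n t u v).comp hinj using 1
  ext1 f
  simp [mulMap_tmul]

/-- The basis of the odd double affine Hecke algebra that consists of the elements `ξ^α σ η^γ`. -/
def pbwBasis : Module.Basis ((Fin n → ℕ) × weylGroup X n × (Fin n → ℕ)) ℂ (HO X n t u v) :=
  ((skewBasis n).tensorProduct
    ((MonoidAlgebra.basis (weylGroup X n) ℂ).tensorProduct (skewBasis n))).map
      (LinearEquiv.ofBijective (mulMap X n t u v) (mulMap_bijective X n t u v))

lemma pbwBasis_apply (α : Fin n → ℕ) (σ : weylGroup X n) (γ : Fin n → ℕ) :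
    pbwBasis X n t u v (α, σ, γ) =
      orderedMonomial (xi X n t u v) α * grp X n t u v σ * orderedMonomial (eta X n t u v) γ := by
  have hσ : MonoidAlgebra.basis (weylGroup X n) ℂ σ = MonoidAlgebra.of ℂ _ σ := by simp
  rw [pbwBasis, Module.Basis.map_apply, Module.Basis.tensorProduct_apply,
    Module.Basis.tensorProduct_apply, LinearEquiv.ofBijective_apply, mulMap_tmul, skewBasis_apply,
    skewBasis_apply, hσ, grpHom_of, map_orderedMonomial, map_orderedMonomial, mul_assoc]
  simp only [xiHom_skewGen, etaHom_skewGen]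

end Representation

end OddDaHa

end

theorem mainTheorem4 (X : OddDaHa.ClassicalType) (n : ℕ) (t u v : ℂ) :
    (Function.Injective (OddDaHa.xiHom X n t u v) ∧
      Function.Injective (OddDaHa.grpHom X n t u v) ∧
      Function.Injective (OddDaHa.etaHom X n t u v)) ∧
    Function.Bijective (OddDaHa.mulMap X n t u v) ∧
    ∃ b : Module.Basis ((Fin n → ℕ) × OddDaHa.weylGroup X n × (Fin n → ℕ)) ℂ
        (OddDaHa.HO X n t u v),
      ∀ (α : Fin n → ℕ) (σ : OddDaHa.weylGroup X n) (γ : Fin n → ℕ),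
        b (α, σ, γ) =
          OddDaHa.orderedMonomial (OddDaHa.xi X n t u v) α *
            OddDaHa.grp X n t u v σ *
            OddDaHa.orderedMonomial (OddDaHa.eta X n t u v) γ :=
  ⟨⟨OddDaHa.xiHom_injective X n t u v, OddDaHa.grpHom_injective X n t u v,
      OddDaHa.etaHom_injective X n t u v⟩,
    OddDaHa.mulMap_bijective X n t u v,
    OddDaHa.pbwBasis X n t u v, OddDaHa.pbwBasis_apply X n t u v⟩
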